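/- All graphs are finite, simple and connected, and $\mathcal L(\mathbb G)$ denotes the Laplacian matrix (degree matrix minus adjacency matrix) of $\mathbb G$. Say that $\mathbb G$ is Laplacian controllable by a single input connected to its vertex $v$ if the system $\dot{x}=-\mathcal L(\mathbb G)x+b\,u(t)$, with $b$ the $0$–$1$ indicator vector of $v$, is controllable, i.e. for all states $x_0,x_1$ there is an input $u$ that transfers the state from $x_0$ to $x_1$ in finite time. Given graphs $\mathbb G_1$, $\mathbb G_2$ and a vertex $s_2$ of $\mathbb G_2$, the composite graph $\mathcal G_1(\mathbb G_2,s_2)$ is obtained by taking one copy of $\mathbb G_2$ for each vertex of $\mathbb G_1$ and joining the copies of $s_2$ in two different copies of $\mathbb G_2$ by an edge exactly when the corresponding vertices of $\mathbb G_1$ are adjacent; thus the copies of $s_2$ alone form $\mathbb G_1$. For a positive integer $j$ let $\mathcal C_j=\{\,j,\ j+(2j+1),\ j+2(2j+1),\ j+3(2j+1),\dots\}$. Corollary. Let $\mathbb G_1$ be a path with $k_1\ge 1$ vertices, and let $q$ be a vertex of the path, with $k_{11}\ge 0$ vertices on one side of it and $k_{12}\ge 0$ on the other, so that $k_{11}+k_{12}=k_1-1$.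 Let $\mathbb G_2$ be a connected graph and $s_2$ a vertex of $\mathbb G_2$ such that the $s_2$-th entry of every eigenvector of $\mathcal L(\mathbb G_2)$ is nonzero. Then the composite graph $\mathcal G_1(\mathbb G_2,s_2)$ is Laplacian controllable by a single input connected to the copy of $s_2$ that corresponds to the vertex $q$ of the path if and only if there is no positive integer $j$ such that $k_{11}$ and $k_{12}$ both belong to $\mathcal C_j$. -/

import Mathlib

open scoped Matrix

namespace LaplacianControl

/-- `x` is a trajectory on `[0, T]` of the linear time-invariant system `ẋ = A x + B u` started at
`x₀` and driven by the input `u`: the input is integrable on `[0, T]` (in particular every piecewise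
continuous input is allowed), `x` is continuous, and the differential equation holds in its
integrated form. -/
structure IsTrajectory {n m : Type*} [Fintype n] [Fintype m]
    (A : Matrix n n ℝ) (B : Matrix n m ℝ) (T : ℝ) (u : ℝ → m → ℝ)
    (x₀ : n → ℝ) (x : ℝ → n → ℝ) : Prop where
  integrable_input : IntervalIntegrable u MeasureTheory.volume 0 T
  continuousOn : ContinuousOn x (Set.Icc 0 T)
  eq_integral : ∀ t ∈ Set.Icc 0 T, x t = x₀ + ∫ r in (0 : ℝ)..t, (A *ᵥ x r + B *ᵥ u r)

/-- The pair `(A, B)` is controllable: for all states `x₀` and `x₁` some input transfers the state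
of `ẋ = A x + B u` from `x₀` to `x₁` in finite time. -/
def IsControllable {n m : Type*} [Fintype n] [Fintype m]
    (A : Matrix n n ℝ) (B : Matrix n m ℝ) : Prop :=
  ∀ x₀ x₁ : n → ℝ, ∃ T : ℝ, 0 < T ∧ ∃ (u : ℝ → m → ℝ) (x : ℝ → n → ℝ),
    IsTrajectory A B T u x₀ x ∧ x T = x₁

/-- The control coefficient matrix of one input that is connected to the vertex `v` only. -/
def inputAt {V : Type*} [DecidableEq V] (v : V) : Matrix V Unit ℝ :=
  fun i _ => if i = v then 1 else 0

/-- The graph `G` is Laplacian controllable by a single input connected to its vertex `v`: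
the system `ẋ = -L x + b u` is controllable, where `L` is the Laplacian matrix of `G` and `b` is the
indicator vector of `v`. -/
def SingleInputLaplacianControllable {V : Type*} [Fintype V] [DecidableEq V]
    (G : SimpleGraph V) [DecidableRel G.Adj] (v : V) : Prop :=
  IsControllable (-(G.lapMatrix ℝ)) (inputAt v)

/-- The composite graph of the structure graph `G₁` by the cell graph `G₂` via the composite vertex
`s` of `G₂`: there is one copy `{a} × V₂` of `G₂` for each vertex `a` of `G₁`, and the copies of
`s` are joined to each other as the vertices of `G₁` are. -/
def composite {V₁ V₂ : Type*} (G₁ : SimpleGraph V₁) (G₂ : SimpleGraph V₂) (s : V₂) :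
    SimpleGraph (V₁ × V₂) where
  Adj a b := (a.1 = b.1 ∧ G₂.Adj a.2 b.2) ∨ (G₁.Adj a.1 b.1 ∧ a.2 = s ∧ b.2 = s)
  symm := ⟨fun _ _ h => h.elim (fun h => Or.inl ⟨h.1.symm, h.2.symm⟩)
    (fun h => Or.inr ⟨h.1.symm, h.2.2, h.2.1⟩)⟩
  loopless := ⟨fun _ h => h.elim (fun h => G₂.irrefl h.2) (fun h => G₁.irrefl h.1)⟩

instance {V₁ V₂ : Type*} [DecidableEq V₁] [DecidableEq V₂]
    (G₁ : SimpleGraph V₁) (G₂ : SimpleGraph V₂) (s : V₂)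
    [DecidableRel G₁.Adj] [DecidableRel G₂.Adj] : DecidableRel (composite G₁ G₂ s).Adj :=
  fun a b => inferInstanceAs (Decidable
    ((a.1 = b.1 ∧ G₂.Adj a.2 b.2) ∨ (G₁.Adj a.1 b.1 ∧ a.2 = s ∧ b.2 = s)))

/-- The set `C_j = {j, j + (2j+1), j + 2(2j+1), …}`. -/
def C (j : ℕ) : Set ℕ := {n | ∃ i : ℕ, n = j + i * (2 * j + 1)}

end LaplacianControl

namespace LaplacianControl

/-! Since the Laplacian is symmetric, controllability fails exactly when some eigenvector vanishes
at the input vertex (`isControllable_iff_forall_eigenvector`). Let `w` be an eigenvector of the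
composite and `z` its values on the copies of `s`. On every cell `(L₂ - μ) w(a,·)` is a multiple of
the indicator of `s`, which forces `z` to be an eigenvector of the path. Conversely, a path
eigenvector `z` lifts to a product `z ⊗ h` (`exists_eigenvector_composite_iff`).

On the path, the free end gives even symmetry about `-1/2` and a zero at `q` gives odd symmetry
about `q`, so the sequence has antiperiod `2q + 1`. Counting from both ends gives antiperiods `2k₁₁
+ 1` and `2k₁₂ + 1`, impossible if these are coprime. A common divisor `2j + 1 > 1` yields an
explicit cosine eigenvector. -/

/-! ### The path recurrence and its symmetries -/

/-- The reflection-symmetric solution of `f (i + 2) = c f (i + 1) - f i` with `f (-1) = f 0 = 1`. -/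
noncomputable def pathSeq (c : ℝ) (i : ℤ) : ℝ :=
  (Polynomial.Chebyshev.S ℝ i).eval c - (Polynomial.Chebyshev.S ℝ (i - 1)).eval c

lemma pathSeq_zero (c : ℝ) : pathSeq c 0 = 1 := by simp [pathSeq]

lemma pathSeq_one (c : ℝ) : pathSeq c 1 = c - 1 := by simp [pathSeq]

lemma pathSeq_neg_one (c : ℝ) : pathSeq c (-1) = 1 := by
  simp [pathSeq]

lemma pathSeq_add_two (c : ℝ) (i : ℤ) :
    pathSeq c (i + 2) = c * pathSeq c (i + 1) - pathSeq c i := by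
  have h1 := Polynomial.Chebyshev.S_add_two ℝ i
  have h2 := Polynomial.Chebyshev.S_add_two ℝ (i - 1)
  rw [show i - 1 + 2 = i + 1 by ring, show i - 1 + 1 = i by ring] at h2
  simp only [pathSeq, show i + 2 - 1 = i + 1 by ring, show i + 1 - 1 = i by ring]
  replace h1 := congrArg (Polynomial.eval c) h1
  replace h2 := congrArg (Polynomial.eval c) h2
  simp only [Polynomial.eval_sub, Polynomial.eval_mul, Polynomial.eval_X] at h1 h2
  linear_combination h1 - h2

/-- Two solutions of the recurrence that agree at two consecutive places agree everywhere. -/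
lemma eq_of_recurrence {c : ℝ} {f g : ℤ → ℝ} (hf : ∀ i, f (i + 2) = c * f (i + 1) - f i)
    (hg : ∀ i, g (i + 2) = c * g (i + 1) - g i) (h0 : f 0 = g 0) (h1 : f 1 = g 1) (i : ℤ) :
    f i = g i := by
  suffices h : ∀ i : ℤ, f i = g i ∧ f (i + 1) = g (i + 1) from (h i).1
  intro i
  induction i using Int.induction_on with
  | zero => exact ⟨h0, by simpa using h1⟩
  | succ i ih =>
    refine ⟨ih.2, ?_⟩
    rw [show (i : ℤ) + 1 + 1 = i + 2 by ring, hf, hg, ih.1, ih.2]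
  | pred i ih =>
    have h2 := hf (-(i : ℤ) - 1)
    have h3 := hg (-(i : ℤ) - 1)
    rw [show -(i : ℤ) - 1 + 2 = -i + 1 by ring, show -(i : ℤ) - 1 + 1 = -i by ring] at h2 h3
    rw [show -(i : ℤ) - 1 + 1 = -i by ring]
    refine ⟨?_, ih.1⟩
    rw [ih.1, ih.2] at h2
    linarith

lemma pathSeq_reflect (c : ℝ) (i : ℤ) : pathSeq c (-1 - i) = pathSeq c i := by
  refine eq_of_recurrence (c := c) (f := fun i => pathSeq c (-1 - i)) (fun i => ?_)
    (pathSeq_add_two c) ?_ ?_ i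
  · have := pathSeq_add_two c (-1 - (i + 2))
    rw [show -1 - (i + 2) + 2 = -1 - i by ring, show -1 - (i + 2) + 1 = -1 - (i + 1) by ring] at this
    linarith
  · simp [pathSeq_zero, pathSeq_neg_one]
  · have := pathSeq_add_two c (-2)
    norm_num [pathSeq_zero, pathSeq_neg_one, pathSeq_one] at this ⊢
    linarith

lemma pathSeq_reflect_of_zero {c : ℝ} {q : ℤ} (hq : pathSeq c q = 0) (i : ℤ) :
    pathSeq c (q + i) = -pathSeq c (q - i) := by
  refine eq_of_recurrence (c := c) (f := fun i => pathSeq c (q + i))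
    (g := fun i => -pathSeq c (q - i)) (fun i => ?_) (fun i => ?_) ?_ ?_ i
  · have := pathSeq_add_two c (q + i)
    simpa only [add_assoc] using this
  · have := pathSeq_add_two c (q - (i + 2))
    rw [show q - (i + 2) + 2 = q - i by ring, show q - (i + 2) + 1 = q - (i + 1) by ring] at this
    linarith
  · simp [hq]
  · have := pathSeq_add_two c (q - 1)
    rw [show q - 1 + 2 = q + 1 by ring, show q - 1 + 1 = q by ring, hq] at this
    linarith

/-- The even reflection about `-1/2` followed by the odd reflection about `q` is a translation by
`2q + 1` with a sign. -/
lemma pathSeq_antiperiodic {c : ℝ} {q : ℤ} (hq : pathSeq c q = 0) :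
    Function.Antiperiodic (pathSeq c) (2 * q + 1) := by
  intro i
  rw [show i + (2 * q + 1) = q + (i + q + 1) by ring, pathSeq_reflect_of_zero hq,
    show q - (i + q + 1) = -1 - i by ring, pathSeq_reflect]

/-- In a Bézout relation for two odd numbers the coefficients have odd sum, so moving from `-1` to
`0` flips the sign; yet both values are `1`. -/
lemma not_isCoprime_of_pathSeq_eq_zero {c : ℝ} {q m : ℤ} (hq : pathSeq c q = 0)
    (hm : pathSeq c m = 0) : ¬ IsCoprime (2 * q + 1) (2 * m + 1) := by
  rintro ⟨x, y, hxy⟩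
  have h : pathSeq c (-1 + x * (2 * q + 1) + y * (2 * m + 1)) = -1 := by
    rw [← smul_eq_mul x, ← smul_eq_mul y, (pathSeq_antiperiodic hm).add_zsmul_eq,
      (pathSeq_antiperiodic hq).add_zsmul_eq, zsmul_eq_mul,
      zsmul_eq_mul, ← mul_assoc, pathSeq_neg_one, mul_one, ← Int.cast_mul, ← Units.val_mul, ← Int.negOnePow_add,
      Int.negOnePow_odd _ ⟨-(y * m) - x * q, by linear_combination hxy⟩]
    simp
  rw [add_assoc, hxy, neg_add_cancel, pathSeq_zero] at h
  norm_num at h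

/-- Membership of `n` in `C j` means `2j + 1 ∣ 2n + 1`, the quotient being automatically odd; the
gcd supplies `j`. -/
lemma exists_mem_C_iff (a b : ℕ) :
    (∃ j : ℕ, 1 ≤ j ∧ a ∈ C j ∧ b ∈ C j) ↔ ¬ IsCoprime (2 * (a : ℤ) + 1) (2 * (b : ℤ) + 1) := by
  have hC : ∀ j n : ℕ, n ∈ C j ↔ 2 * j + 1 ∣ 2 * n + 1 := by
    intro j n
    constructor
    · rintro ⟨i, rfl⟩
      exact ⟨2 * i + 1, by ring⟩
    · rintro ⟨d, hd⟩
      obtain ⟨i, rfl⟩ : Odd d := (Nat.odd_mul.1 (hd ▸ odd_two_mul_add_one n)).2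
      exact ⟨i, by linarith⟩
  have hco : IsCoprime (2 * (a : ℤ) + 1) (2 * (b : ℤ) + 1) ↔
      Nat.Coprime (2 * a + 1) (2 * b + 1) := by
    rw [← Nat.isCoprime_iff_coprime]
    push_cast
    rfl
  simp only [hC, hco]
  constructor
  · rintro ⟨j, hj, ha, hb⟩ h
    have := Nat.eq_one_of_dvd_coprimes h ha hb
    omega
  · intro h
    obtain ⟨j, hj⟩ : Odd (Nat.gcd (2 * a + 1) (2 * b + 1)) :=
      (odd_two_mul_add_one a).of_dvd_nat (Nat.gcd_dvd_left _ _)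
    refine ⟨j, ?_, hj ▸ Nat.gcd_dvd_left _ _, hj ▸ Nat.gcd_dvd_right _ _⟩
    rw [Nat.coprime_iff_gcd_eq_one] at h
    omega

/-! ### Eigenvectors of the path -/

/-- The first `k` values of `Z` satisfy the eigenvector equations, with eigenvalue `ν`, of the
Laplacian of the path with `k` vertices. -/
def IsPathEigen (k : ℕ) (ν : ℝ) (Z : ℕ → ℝ) : Prop :=
  ∀ i < k, (if i + 1 < k then Z i - Z (i + 1) else 0) + (if 1 ≤ i then Z i - Z (i - 1) else 0) =
    ν * Z i

lemma IsPathEigen.eq_pathSeq {k : ℕ} {ν : ℝ} {Z : ℕ → ℝ} (h : IsPathEigen k ν Z) :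
    ∀ i < k, Z i = Z 0 * pathSeq (2 - ν) i := by
  intro i
  induction i using Nat.twoStepInduction with
  | zero => simp [pathSeq_zero]
  | one =>
    intro hk
    have := h 0 (by omega)
    simp [hk] at this
    simp [pathSeq_one]
    linarith
  | more i ih0 ih1 =>
    intro hk
    have := h (i + 1) (by omega)
    rw [if_pos hk, if_pos (by omega), Nat.add_sub_cancel, ih0 (by omega), ih1 (by omega)] at this
    have h2 := pathSeq_add_two (2 - ν) i
    push_cast at this ⊢
    rw [h2]
    linarith

lemma IsPathEigen.reverse {k : ℕ} {ν : ℝ} {Z : ℕ → ℝ} (h : IsPathEigen k ν Z) :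
    IsPathEigen k ν (fun i => Z (k - 1 - i)) := by
  intro i hi
  have := h (k - 1 - i) (by omega)
  rw [← this, add_comm]
  congr 1
  · by_cases h1 : 1 ≤ i
    · rw [if_pos h1, if_pos (by omega), show k - 1 - i + 1 = k - 1 - (i - 1) by omega]
    · rw [if_neg h1, if_neg (by omega)]
  · by_cases h1 : i + 1 < k
    · rw [if_pos h1, if_pos (by omega), show k - 1 - i - 1 = k - 1 - (i + 1) by omega]
    · rw [if_neg h1, if_neg (by omega)]

lemma IsPathEigen.not_isCoprime {a b : ℕ} {ν : ℝ} {Z : ℕ → ℝ} (h : IsPathEigen (a + b + 1) ν Z)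
    (ha : Z a = 0) (hZ : ∃ i < a + b + 1, Z i ≠ 0) :
    ¬ IsCoprime (2 * (a : ℤ) + 1) (2 * (b : ℤ) + 1) := by
  obtain ⟨i, hi, hZi⟩ := hZ
  have h1 := h.eq_pathSeq
  have h2 := h.reverse.eq_pathSeq
  refine not_isCoprime_of_pathSeq_eq_zero (c := 2 - ν) ?_ ?_
  · refine (mul_eq_zero.1 ((h1 a (by omega)).symm.trans ha)).resolve_left fun h0 => hZi ?_
    rw [h1 i hi, h0, zero_mul]
  · have hb := h2 b (by omega)
    rw [show a + b + 1 - 1 - b = a by omega, ha] at hb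
    refine (mul_eq_zero.1 hb.symm).resolve_left fun h0 => hZi ?_
    have := h2 (a + b - i) (by omega)
    rwa [h0, zero_mul, show a + b + 1 - 1 - (a + b - i) = i by omega] at this

lemma exists_isPathEigen {a b : ℕ} (h : ¬ IsCoprime (2 * (a : ℤ) + 1) (2 * (b : ℤ) + 1)) :
    ∃ (ν : ℝ) (Z : ℕ → ℝ), IsPathEigen (a + b + 1) ν Z ∧ Z a = 0 ∧ Z 0 ≠ 0 := by
  obtain ⟨j, hj, ⟨x, hx⟩, ⟨y, hy⟩⟩ := (exists_mem_C_iff a b).2 h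
  have hd : (0 : ℝ) < 2 * j + 1 := by positivity
  have hx' : (a : ℝ) = j + x * (2 * j + 1) := by exact_mod_cast hx
  have hy' : (b : ℝ) = j + y * (2 * j + 1) := by exact_mod_cast hy
  -- Chosen so that `(a + 1/2) θ` is an odd multiple of `π/2` and `(a + b + 1) θ` a multiple of `π`;
  -- cosine is even about the latter, which is the free-end condition.
  set θ : ℝ := Real.pi / (2 * j + 1) with hθ
  have hθd : θ * (2 * j + 1) = Real.pi := by rw [hθ]; field_simp
  have hrec : ∀ t : ℝ, Real.cos (t + θ) + Real.cos (t - θ) = 2 * Real.cos θ * Real.cos t := by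
    intro t
    rw [Real.cos_add, Real.cos_sub]
    ring
  have hend : Real.cos (((a + b + 1 : ℝ) + 1 / 2) * θ) = Real.cos (((a + b : ℝ) + 1 / 2) * θ) := by
    have e1 : ((a + b + 1 : ℝ) + 1 / 2) * θ = θ / 2 + ((x + y + 1 : ℕ) : ℝ) * Real.pi := by
      rw [hx', hy', ← hθd]; push_cast; ring
    have e2 : ((a + b : ℝ) + 1 / 2) * θ = -(θ / 2) + ((x + y + 1 : ℕ) : ℝ) * Real.pi := by
      rw [hx', hy', ← hθd]; push_cast; ring
    rw [e1, e2, Real.cos_add_nat_mul_pi, Real.cos_add_nat_mul_pi, Real.cos_neg]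
  refine ⟨2 - 2 * Real.cos θ, fun i => Real.cos ((i + 1 / 2) * θ), ?_, ?_, ?_⟩
  · intro i hi
    have hi2 := hrec ((i + 1 / 2) * θ)
    rw [show (i + 1 / 2) * θ + θ = ((i : ℝ) + 1 + 1 / 2) * θ by ring,
      show (i + 1 / 2) * θ - θ = ((i : ℝ) - 1 + 1 / 2) * θ by ring] at hi2
    have hL : (if i + 1 < a + b + 1 then Real.cos ((i + 1 / 2) * θ) -
        Real.cos (((i + 1 : ℕ) + 1 / 2) * θ) else 0) =
        Real.cos ((i + 1 / 2) * θ) - Real.cos (((i : ℝ) + 1 + 1 / 2) * θ) := by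
      split_ifs with h1
      · push_cast; rfl
      · obtain rfl : i = a + b := by omega
        push_cast
        rw [hend, sub_self]
    have hR : (if 1 ≤ i then Real.cos ((i + 1 / 2) * θ) -
        Real.cos (((i - 1 : ℕ) + 1 / 2) * θ) else 0) =
        Real.cos ((i + 1 / 2) * θ) - Real.cos (((i : ℝ) - 1 + 1 / 2) * θ) := by
      split_ifs with h1
      · push_cast [h1]; rfl
      · obtain rfl : i = 0 := by omega
        rw [show (((0 : ℕ) : ℝ) - 1 + 1 / 2) * θ = -((((0 : ℕ) : ℝ) + 1 / 2) * θ) by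
          push_cast; ring, Real.cos_neg, sub_self]
    rw [hL, hR]
    linear_combination -hi2
  · have e1 : ((a : ℝ) + 1 / 2) * θ = Real.pi / 2 + (x : ℝ) * Real.pi := by
      rw [hx', ← hθd]; ring
    simp only [e1, Real.cos_add_nat_mul_pi, Real.cos_pi_div_two, mul_zero]
  -- Here `j ≥ 1` is essential: for `j = 0` the value `cos (θ/2)` would be zero.
  · have hj' : (1 : ℝ) ≤ j := by exact_mod_cast hj
    refine (Real.cos_pos_of_mem_Ioo ⟨?_, ?_⟩).ne' <;> push_cast <;>
      nlinarith [Real.pi_pos, div_pos Real.pi_pos hd]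

/-! ### Eigenvectors of the composite graph -/

lemma lapMatrix_mulVec_eq_sum {V : Type*} [Fintype V] [DecidableEq V] (G : SimpleGraph V)
    [DecidableRel G.Adj] (f : V → ℝ) (a : V) :
    (G.lapMatrix ℝ *ᵥ f) a = ∑ b, if G.Adj a b then f a - f b else 0 := by
  rw [SimpleGraph.lapMatrix_mulVec_apply, ← Finset.sum_filter, Finset.sum_sub_distrib,
    ← SimpleGraph.neighborFinset_eq_filter, Finset.sum_const, SimpleGraph.card_neighborFinset_eq_degree,
    nsmul_eq_mul]

lemma lapMatrix_composite_mulVec {V₁ V₂ : Type*} [Fintype V₁] [DecidableEq V₁] [Fintype V₂]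
    [DecidableEq V₂] (G₁ : SimpleGraph V₁) [DecidableRel G₁.Adj] (G₂ : SimpleGraph V₂)
    [DecidableRel G₂.Adj] (s : V₂) (w : V₁ × V₂ → ℝ) (a : V₁) (x : V₂) :
    ((composite G₁ G₂ s).lapMatrix ℝ *ᵥ w) (a, x) =
      (G₂.lapMatrix ℝ *ᵥ fun y => w (a, y)) x +
        if x = s then (G₁.lapMatrix ℝ *ᵥ fun b => w (b, s)) a else 0 := by
  simp only [lapMatrix_mulVec_eq_sum, Fintype.sum_prod_type]
  have key : ∀ b y, (if (composite G₁ G₂ s).Adj (a, x) (b, y) then w (a, x) - w (b, y) else 0) =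
      (if a = b then if G₂.Adj x y then w (a, x) - w (b, y) else 0 else 0) +
      (if y = s then if x = s then if G₁.Adj a b then w (a, s) - w (b, s) else 0 else 0 else 0) := by
    intro b y
    by_cases h1 : a = b
    · subst h1
      by_cases h2 : G₂.Adj x y <;> simp [composite, h2]
    · by_cases h2 : G₁.Adj a b <;> by_cases h3 : x = s <;> by_cases h4 : y = s <;>
        simp [composite, h1, h2, h3, h4]
  simp only [key, Finset.sum_add_distrib]
  congr 1
  · rw [Finset.sum_comm]
    simp
  · simp only [Finset.sum_ite_eq', Finset.mem_univ, if_true]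
    split_ifs <;> simp

/-- A symmetric operator stays symmetric on an invariant subspace, so the spectral theorem applies
there. -/
lemma exists_eigenvector_mem {n : Type*} [Fintype n] [DecidableEq n] {A : Matrix n n ℝ}
    (hA : A.IsSymm) {N : Submodule ℝ (n → ℝ)} (hN : ∀ v ∈ N, A *ᵥ v ∈ N) (hbot : N ≠ ⊥) :
    ∃ (μ : ℝ) (v : n → ℝ), v ∈ N ∧ v ≠ 0 ∧ A *ᵥ v = μ • v := by
  have hT : A.toEuclideanLin.IsSymmetric := Matrix.isSymmetric_toEuclideanLin_iff.2
    (by rw [Matrix.IsHermitian, Matrix.conjTranspose_eq_transpose_of_trivial]; exact hA)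
  set N' : Submodule ℝ (EuclideanSpace ℝ n) :=
    N.comap (WithLp.linearEquiv 2 ℝ (n → ℝ)).toLinearMap with hN'
  have hinv : ∀ v ∈ N', A.toEuclideanLin v ∈ N' := fun v hv => hN _ hv
  by_contra! hcon
  have hsub := (hT.restrict_invariant hinv).subsingleton_of_no_eigenvalue_finiteDimensional
    (fun μ => by
      rw [Submodule.eq_bot_iff]
      rintro ⟨v, hv⟩ hμ
      rw [Module.End.mem_eigenspace_iff] at hμ
      by_contra hne
      refine hcon μ (WithLp.ofLp v) hv (fun h0 => hne ?_) ?_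
      · ext i
        exact congrFun h0 i
      · have := congrArg (fun z : N' => WithLp.ofLp (z : EuclideanSpace ℝ n)) hμ
        exact this)
  refine hbot ((Submodule.eq_bot_iff _).2 fun v hv => ?_)
  have := @Subsingleton.elim _ hsub ⟨WithLp.toLp 2 v, hv⟩ 0
  exact congrArg (fun z : N' => WithLp.ofLp (z : EuclideanSpace ℝ n)) this

/-- The Laplacian of the composite graph has a nonzero eigenvector that vanishes at `(p, s)` if and
only if the Laplacian of the structure graph has one that vanishes at `p`. -/
lemma exists_eigenvector_composite_iff {V₁ V₂ : Type*} [Fintype V₁] [DecidableEq V₁] [Fintype V₂]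
    [DecidableEq V₂] (G₁ : SimpleGraph V₁) [DecidableRel G₁.Adj] (G₂ : SimpleGraph V₂)
    [DecidableRel G₂.Adj] (s : V₂) (p : V₁)
    (hs : ∀ (μ : ℝ) (v : V₂ → ℝ), G₂.lapMatrix ℝ *ᵥ v = μ • v → v s = 0 → v = 0) :
    (∃ (μ : ℝ) (w : V₁ × V₂ → ℝ), (composite G₁ G₂ s).lapMatrix ℝ *ᵥ w = μ • w ∧
      w (p, s) = 0 ∧ w ≠ 0) ↔
    ∃ (ν : ℝ) (z : V₁ → ℝ), G₁.lapMatrix ℝ *ᵥ z = ν • z ∧ z p = 0 ∧ z ≠ 0 := by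
  constructor
  · rintro ⟨μ, w, hw, hp, hw0⟩
    set z : V₁ → ℝ := fun a => w (a, s) with hz
    have hcell : ∀ a, (G₂.lapMatrix ℝ *ᵥ fun y => w (a, y)) - μ • (fun y => w (a, y)) =
        -(G₁.lapMatrix ℝ *ᵥ z) a • Pi.single s 1 := by
      intro a
      ext x
      have := congrFun hw (a, x)
      rw [lapMatrix_composite_mulVec] at this
      simp only [Pi.smul_apply, smul_eq_mul, Pi.sub_apply, Pi.single_apply] at this ⊢
      rw [← this]
      split_ifs <;> simp [hz]
    have hz0 : z ≠ 0 := by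
      intro h0
      refine hw0 (funext fun ⟨a, x⟩ => ?_)
      have h1 := hcell a
      rw [h0, Matrix.mulVec_zero, Pi.zero_apply, neg_zero, zero_smul, sub_eq_zero] at h1
      exact congrFun (hs μ _ h1 (congrFun h0 a)) x
    -- If `μ` is not an eigenvalue of the cell, every cell vector is a multiple of one `h` solving
    -- `(L₂ - μ) h = e_s`.
    by_cases hinj : ∀ v : V₂ → ℝ, G₂.lapMatrix ℝ *ᵥ v = μ • v → v = 0
    · have hker : LinearMap.ker ((G₂.lapMatrix ℝ).toLin' - μ • LinearMap.id) = ⊥ := by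
        rw [LinearMap.ker_eq_bot']
        intro v hv
        exact hinj v (sub_eq_zero.1 (by simpa using hv))
      obtain ⟨h, hh⟩ := LinearMap.surjective_of_injective (LinearMap.ker_eq_bot.1 hker)
        (Pi.single s 1)
      have hwh : ∀ a, (fun y => w (a, y)) = -(G₁.lapMatrix ℝ *ᵥ z) a • h := by
        intro a
        apply LinearMap.ker_eq_bot.1 hker
        rw [map_smul, hh, ← hcell a]
        simp
      have hzh : ∀ a, z a = -(G₁.lapMatrix ℝ *ᵥ z) a * h s := fun a => congrFun (hwh a) s
      have hhs : h s ≠ 0 := by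
        intro h0
        exact hz0 (funext fun a => by rw [hzh, h0, mul_zero, Pi.zero_apply])
      refine ⟨-(h s)⁻¹, z, ?_, hp, hz0⟩
      ext a
      rw [Pi.smul_apply, smul_eq_mul, hzh a]
      field_simp
    · push Not at hinj
      obtain ⟨v, hv, hv0⟩ := hinj
      have hvs : v s ≠ 0 := fun h => hv0 (hs μ v hv h)
      refine ⟨0, z, ?_, hp, hz0⟩
      ext a
      -- Pairing with the cell eigenvector `v` kills the left side; since `v s ≠ 0`, `L₁ z = 0`.
      have h1 := congrArg (v ⬝ᵥ ·) (hcell a)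
      simp only [dotProduct_sub, dotProduct_smul, Matrix.dotProduct_mulVec] at h1
      rw [← Matrix.mulVec_transpose, G₂.isSymm_lapMatrix (R := ℝ), hv, smul_dotProduct, sub_self,
        dotProduct_single, mul_one, smul_eq_mul] at h1
      simpa [hvs] using h1.symm
  · rintro ⟨ν, z, hz, hp, hz0⟩
    -- The factor `h` must be an eigenvector of the cell Laplacian perturbed by `ν` at `s`.
    have hsymm : (G₂.lapMatrix ℝ + Matrix.diagonal (Pi.single s ν)).IsSymm :=
      (G₂.isSymm_lapMatrix (R := ℝ)).add (Matrix.isSymm_diagonal _)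
    obtain ⟨μ, h, -, hh0, hh⟩ := exists_eigenvector_mem hsymm (N := ⊤) (fun _ _ => trivial)
      (fun htop => one_ne_zero (α := ℝ) (congrFun ((Submodule.eq_bot_iff _).1 htop 1 trivial) s))
    have hh' : ∀ x, (G₂.lapMatrix ℝ *ᵥ h) x + (if x = s then ν * h s else 0) = μ * h x := by
      intro x
      have := congrFun hh x
      rw [Matrix.add_mulVec, Pi.add_apply, Matrix.mulVec_diagonal, Pi.single_apply] at this
      rw [← smul_eq_mul μ, ← Pi.smul_apply, ← this]
      split_ifs with hx
      · rw [hx]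
      · rw [zero_mul]
    have hhs : h s ≠ 0 := by
      intro h0
      refine hh0 (hs μ h (funext fun x => ?_) h0)
      simpa [h0] using hh' x
    refine ⟨μ, fun c => z c.1 * h c.2, ?_, by simp [hp], fun h0 => hz0 (funext fun a => ?_)⟩
    · ext ⟨a, x⟩
      rw [lapMatrix_composite_mulVec]
      have e1 : (fun y => z a * h y) = z a • h := rfl
      have e2 : (fun b => z b * h s) = h s • z := by ext b; simp [mul_comm]
      rw [e1, e2, Matrix.mulVec_smul, Matrix.mulVec_smul, hz]
      simp only [Pi.smul_apply, smul_eq_mul]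
      rw [mul_left_comm μ, ← hh' x]
      split_ifs <;> ring
    · simpa [hhs] using congrFun h0 (a, s)

/-! ### Controllability and the eigenvector test -/

/-- A continuous solution of `y = μ ∫₀ y` on `[0, T]` vanishes. -/
lemma eq_zero_of_eq_mul_integral {y : ℝ → ℝ} {μ T : ℝ} (hT : 0 ≤ T)
    (hy : ContinuousOn y (Set.Icc 0 T))
    (h : ∀ t ∈ Set.Icc 0 T, y t = μ * ∫ r in (0 : ℝ)..t, y r) : y T = 0 := by
  -- Extending `y` continuously to the line makes its integral differentiable everywhere; an
  -- integrating factor then finishes.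
  set g : ℝ → ℝ := Set.IccExtend hT ((Set.Icc 0 T).domRestrict y) with hg
  have hgc : Continuous g := hy.domRestrict.Icc_extend'
  have hgy : ∀ t ∈ Set.Icc 0 T, g t = y t := fun t ht => by
    rw [hg, Set.IccExtend_of_mem hT _ ht, Set.domRestrict_apply]
  have hint : ∀ t ∈ Set.Icc 0 T, ∫ r in (0 : ℝ)..t, y r = ∫ r in (0 : ℝ)..t, g r := by
    intro t ht
    refine intervalIntegral.integral_congr fun r hr => (hgy r ?_).symm
    rw [Set.uIcc_of_le ht.1] at hr
    exact ⟨hr.1, hr.2.trans ht.2⟩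
  set F : ℝ → ℝ := fun t => Real.exp (-μ * t) * ∫ r in (0 : ℝ)..t, g r with hF
  have hFd : ∀ t, HasDerivAt F (Real.exp (-μ * t) * (g t - μ * ∫ r in (0 : ℝ)..t, g r)) t := by
    intro t
    have h1 : HasDerivAt (fun t => Real.exp (-μ * t)) (Real.exp (-μ * t) * (-μ)) t := by
      simpa using ((hasDerivAt_id t).const_mul (-μ)).exp
    refine (h1.mul (hgc.integral_hasStrictDerivAt 0 t).hasDerivAt).congr_deriv ?_
    ring
  have hconst := constant_of_has_deriv_right_zero (f := F) (a := 0) (b := T)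
    (fun t _ => (hFd t).continuousAt.continuousWithinAt) (fun t ht => by
      have ht' : t ∈ Set.Icc 0 T := ⟨ht.1, ht.2.le⟩
      have := hFd t
      rw [hgy t ht', h t ht', hint t ht', sub_self, mul_zero] at this
      exact this.hasDerivWithinAt) T ⟨hT, le_rfl⟩
  simp only [hF, intervalIntegral.integral_same, mul_zero] at hconst
  rw [h T ⟨hT, le_rfl⟩, hint T ⟨hT, le_rfl⟩,
    (mul_eq_zero.1 hconst).resolve_left (Real.exp_pos _).ne', mul_zero]

/-- Along any trajectory from `0`, `v ⬝ᵥ x` solves `ẏ = μ y` and stays zero; steering to `v` itself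
gives `v ⬝ᵥ v = 0`. -/
lemma IsControllable.eq_zero_of_eigenvector {n m : Type*} [Fintype n] [Fintype m]
    {A : Matrix n n ℝ} {B : Matrix n m ℝ} (hAB : IsControllable A B) {μ : ℝ} {v : n → ℝ}
    (hv : v ᵥ* A = μ • v) (hB : v ᵥ* B = 0) : v = 0 := by
  obtain ⟨T, hT, u, x, hx, hxT⟩ := hAB 0 v
  let ℓ : (n → ℝ) →L[ℝ] ℝ := LinearMap.toContinuousLinearMap (dotProductBilin ℝ ℝ v)
  have hℓ : ∀ y, ℓ y = v ⬝ᵥ y := fun y => rfl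
  have hbB : Continuous fun y : m → ℝ => B *ᵥ y :=
    (LinearMap.toContinuousLinearMap B.mulVecLin).continuous
  have hbA : Continuous fun y : n → ℝ => A *ᵥ y :=
    (LinearMap.toContinuousLinearMap A.mulVecLin).continuous
  have hy : ContinuousOn (fun t => v ⬝ᵥ x t) (Set.Icc 0 T) :=
    ℓ.continuous.comp_continuousOn hx.continuousOn
  have := eq_zero_of_eq_mul_integral (μ := μ) hT.le hy fun t ht => ?_
  · simpa [hxT, dotProduct_self_eq_zero] using this
  have hsub : Set.uIcc 0 t ⊆ Set.Icc 0 T := by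
    rw [Set.uIcc_of_le ht.1]
    exact Set.Icc_subset_Icc_right ht.2
  have hsub' : Set.uIcc 0 t ⊆ Set.uIcc 0 T := by rwa [Set.uIcc_of_le hT.le]
  have h1 : IntervalIntegrable (fun r => A *ᵥ x r) MeasureTheory.volume 0 t :=
    (hbA.comp_continuousOn (hx.continuousOn.mono hsub)).intervalIntegrable
  have h2 : IntervalIntegrable (fun r => B *ᵥ u r) MeasureTheory.volume 0 t :=
    have hu := hx.integrable_input.mono_set hsub'
    ⟨(LinearMap.toContinuousLinearMap B.mulVecLin).integrable_comp hu.1,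
      (LinearMap.toContinuousLinearMap B.mulVecLin).integrable_comp hu.2⟩
  rw [hx.eq_integral t ht, zero_add, ← hℓ, ← ℓ.intervalIntegral_comp_comm (h1.add h2),
    ← intervalIntegral.integral_const_mul]
  refine intervalIntegral.integral_congr fun r _ => ?_
  simp only [hℓ, dotProduct_add, Matrix.dotProduct_mulVec, hv, hB, zero_dotProduct, add_zero,
    smul_dotProduct, smul_eq_mul]

/-- The matrix exponential `exp (t A)` as a continuous linear map. -/
noncomputable def flow {n : Type*} [Fintype n] (A : Matrix n n ℝ) (t : ℝ) :
    (n → ℝ) →L[ℝ] (n → ℝ) :=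
  NormedSpace.exp (t • LinearMap.toContinuousLinearMap A.mulVecLin)

section flow

variable {n m : Type*} [Fintype n] [Fintype m] (A : Matrix n n ℝ) (B : Matrix n m ℝ)

lemma flow_zero : flow A 0 = 1 := by simp [flow]

lemma flow_mul_flow_neg (t : ℝ) : flow A t * flow A (-t) = 1 := by
  let _ := NormedAlgebra.restrictScalars ℚ ℝ ((n → ℝ) →L[ℝ] (n → ℝ))
  rw [flow, flow, ← NormedSpace.exp_add_of_commute]
  · rw [← add_smul, add_neg_cancel, zero_smul, NormedSpace.exp_zero]
  · exact ((Commute.refl _).smul_left _).smul_right _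

lemma hasDerivAt_flow (t : ℝ) :
    HasDerivAt (flow A) (LinearMap.toContinuousLinearMap A.mulVecLin * flow A t) t :=
  hasDerivAt_exp_smul_const' (𝕂 := ℝ) (LinearMap.toContinuousLinearMap A.mulVecLin) t

lemma continuous_flow : Continuous (flow A) :=
  continuous_iff_continuousAt.2 fun t => (hasDerivAt_flow A t).continuousAt

lemma hasDerivAt_flow_neg_apply (t : ℝ) (b : n → ℝ) :
    HasDerivAt (fun t => flow A (-t) b) (-(A *ᵥ flow A (-t) b)) t := by
  have h := (hasDerivAt_flow A (-t)).scomp t (hasDerivAt_neg t)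
  refine (h.clm_apply (hasDerivAt_const t b)).congr_deriv ?_
  simp

lemma continuous_flow_neg_mulVec {u : ℝ → m → ℝ} (hu : Continuous u) :
    Continuous fun r => flow A (-r) (B *ᵥ u r) :=
  ((continuous_flow A).comp continuous_neg).clm_apply
    ((LinearMap.toContinuousLinearMap B.mulVecLin).continuous.comp hu)

/-- Variation of constants. -/
lemma isTrajectory_flow {u : ℝ → m → ℝ} (hu : Continuous u) (x₀ : n → ℝ) (T : ℝ) :
    IsTrajectory A B T u x₀
      (fun t => flow A t (x₀ + ∫ r in (0 : ℝ)..t, flow A (-r) (B *ᵥ u r))) := by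
  set x : ℝ → n → ℝ := fun t => flow A t (x₀ + ∫ r in (0 : ℝ)..t, flow A (-r) (B *ᵥ u r)) with hx
  have hd : ∀ t, HasDerivAt x (A *ᵥ x t + B *ᵥ u t) t := by
    intro t
    have h1 := ((continuous_flow_neg_mulVec A B hu).integral_hasStrictDerivAt 0 t).hasDerivAt
    refine ((hasDerivAt_flow A t).clm_apply (h1.const_add x₀)).congr_deriv ?_
    have h2 := congrArg (fun f => f (B *ᵥ u t)) (flow_mul_flow_neg A t)
    simp only [mul_apply_eq_comp, one_apply_eq_self] at h2
    rw [h2]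
    rfl
  have hxc : Continuous x := continuous_iff_continuousAt.2 fun t => (hd t).continuousAt
  refine ⟨hu.intervalIntegrable _ _, hxc.continuousOn, fun t _ => ?_⟩
  rw [intervalIntegral.integral_eq_sub_of_hasDerivAt (fun r _ => hd r)]
  · simp [hx, flow_zero]
  · exact Continuous.intervalIntegrable
      (((LinearMap.toContinuousLinearMap A.mulVecLin).continuous.comp hxc).add
      ((LinearMap.toContinuousLinearMap B.mulVecLin).continuous.comp hu)) _ _

/-- The effect at time `1`, pulled back to time `0`, of a continuous input. -/
noncomputable def inputResponse : C(ℝ, m → ℝ) →ₗ[ℝ] (n → ℝ) where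
  toFun u := ∫ r in (0 : ℝ)..1, flow A (-r) (B *ᵥ u r)
  map_add' u v := by
    rw [← intervalIntegral.integral_add
      ((continuous_flow_neg_mulVec A B u.continuous).intervalIntegrable _ _)
      ((continuous_flow_neg_mulVec A B v.continuous).intervalIntegrable _ _)]
    simp [Matrix.mulVec_add]
  map_smul' c u := by
    rw [RingHom.id_apply, ← intervalIntegral.integral_smul]
    simp [Matrix.mulVec_smul]

lemma isControllable_of_surjective (h : Function.Surjective (inputResponse A B)) :
    IsControllable A B := by
  intro x₀ x₁
  obtain ⟨u, hu⟩ := h (flow A (-1) x₁ - x₀)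
  refine ⟨1, one_pos, u, _, isTrajectory_flow A B u.continuous x₀ 1, ?_⟩
  change flow A 1 (x₀ + inputResponse A B u) = x₁
  rw [hu, add_sub_cancel, ← mul_apply_eq_comp, flow_mul_flow_neg,
    one_apply_eq_self]

/-- Gramian argument: testing `v` against the input `u = Bᵀ exp(-rA)ᵀ v` makes the integral of
`|u|²` vanish. -/
lemma dotProduct_flow_eq_zero {v : n → ℝ} (hv : ∀ u, v ⬝ᵥ inputResponse A B u = 0)
    {t : ℝ} (ht : t ∈ Set.Ioo (0 : ℝ) 1) (y : m → ℝ) : v ⬝ᵥ flow A (-t) (B *ᵥ y) = 0 := by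
  classical
  let ℓ : (n → ℝ) →L[ℝ] ℝ := LinearMap.toContinuousLinearMap (dotProductBilin ℝ ℝ v)
  have hℓ : ∀ y, ℓ y = v ⬝ᵥ y := fun y => rfl
  have hc : ∀ i, Continuous fun r => v ⬝ᵥ flow A (-r) (B *ᵥ Pi.single i 1) := fun i =>
    ℓ.continuous.comp (continuous_flow_neg_mulVec A B continuous_const)
  let u : C(ℝ, m → ℝ) :=
    ⟨fun r i => v ⬝ᵥ flow A (-r) (B *ᵥ Pi.single i 1), continuous_pi hc⟩
  have hlin : ∀ r (y : m → ℝ), v ⬝ᵥ flow A (-r) (B *ᵥ y) = ∑ i, y i * u r i := by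
    intro r y
    let φ : (m → ℝ) →ₗ[ℝ] ℝ := ℓ.toLinearMap ∘ₗ (flow A (-r)).toLinearMap ∘ₗ B.mulVecLin
    have := LinearMap.pi_apply_eq_sum_univ φ y
    refine this.trans (Finset.sum_congr rfl fun i _ => ?_)
    rw [smul_eq_mul]
    congr 1
    change v ⬝ᵥ flow A (-r) (B *ᵥ _) = v ⬝ᵥ flow A (-r) (B *ᵥ Pi.single i 1)
    congr 3
    ext j
    simp [Pi.single_apply, eq_comm]
  have h0 : ∫ r in (0 : ℝ)..1, ∑ i, u r i * u r i = 0 := by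
    refine Eq.trans ?_ ((ℓ.intervalIntegral_comp_comm
      ((continuous_flow_neg_mulVec A B u.continuous).intervalIntegrable _ _)).trans (hv u))
    exact intervalIntegral.integral_congr fun r _ => (hlin r (u r)).symm
  have hcont : Continuous fun r => ∑ i, u r i * u r i :=
    continuous_finsetSum _ fun i _ => (hc i).mul (hc i)
  have hnn : ∀ r, 0 ≤ ∑ i, u r i * u r i :=
    fun r => Finset.sum_nonneg fun i _ => mul_self_nonneg _
  have hut : ∑ i, u t i * u t i = 0 := by
    by_contra hne
    refine (intervalIntegral.integral_pos zero_lt_one hcont.continuousOn (fun r _ => hnn r)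
      ⟨t, Set.Ioo_subset_Icc_self ht, lt_of_le_of_ne (hnn t) (Ne.symm hne)⟩).ne' h0
  rw [hlin]
  refine Finset.sum_eq_zero fun i hi => ?_
  rw [mul_self_eq_zero.1 ((Finset.sum_eq_zero_iff_of_nonneg fun i _ => mul_self_nonneg _).1 hut i hi),
    mul_zero]

end flow

/-- The Popov–Belevitch–Hautus test for a symmetric system matrix. -/
theorem isControllable_iff_forall_eigenvector {n m : Type*} [Fintype n] [Fintype m]
    {A : Matrix n n ℝ} (hA : A.IsSymm) (B : Matrix n m ℝ) :
    IsControllable A B ↔ ∀ (μ : ℝ) (v : n → ℝ), A *ᵥ v = μ • v → v ᵥ* B = 0 → v = 0 := by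
  classical
  have hAv : ∀ v : n → ℝ, v ᵥ* A = A *ᵥ v := fun v => by rw [← Matrix.mulVec_transpose, hA]
  refine ⟨fun h μ v hv => h.eq_zero_of_eigenvector ((hAv v).trans hv), fun h => ?_⟩
  refine isControllable_of_surjective A B (LinearMap.range_eq_top.1 ?_)
  by_contra hne
  obtain ⟨f, hf0, hf⟩ := Submodule.exists_le_ker_of_lt_top _ (lt_top_iff_ne_top.2 hne)
  -- Differentiating the defining identity in `t` shows that `N` is `A`-invariant; the open interval
  -- permits this. A functional vanishing on the range of `inputResponse` makes `N` nonzero.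
  let N : Submodule ℝ (n → ℝ) :=
    { carrier := {v | ∀ t ∈ Set.Ioo (0 : ℝ) 1, ∀ y, v ⬝ᵥ flow A (-t) (B *ᵥ y) = 0}
      add_mem' := fun ha hb t ht y => by rw [add_dotProduct, ha t ht, hb t ht, add_zero]
      zero_mem' := fun t _ y => zero_dotProduct _
      smul_mem' := fun c v hv t ht y => by rw [smul_dotProduct, hv t ht, smul_zero] }
  have hinv : ∀ v ∈ N, A *ᵥ v ∈ N := by
    intro v hv t ht y
    let ℓ : (n → ℝ) →L[ℝ] ℝ := LinearMap.toContinuousLinearMap (dotProductBilin ℝ ℝ v)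
    have h1 : HasDerivAt (fun t => v ⬝ᵥ flow A (-t) (B *ᵥ y))
        (v ⬝ᵥ -(A *ᵥ flow A (-t) (B *ᵥ y))) t :=
      ℓ.hasFDerivAt.comp_hasDerivAt t (hasDerivAt_flow_neg_apply A t (B *ᵥ y))
    have h2 : HasDerivAt (fun t => v ⬝ᵥ flow A (-t) (B *ᵥ y)) 0 t :=
      (hasDerivAt_const t (0 : ℝ)).congr_of_eventuallyEq
        (Filter.eventuallyEq_of_mem (isOpen_Ioo.mem_nhds ht) fun r hr => hv r hr y)
    have h3 := h1.unique h2
    rwa [dotProduct_neg, neg_eq_zero, Matrix.dotProduct_mulVec, hAv] at h3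
  have hbot : N ≠ ⊥ := by
    intro hN
    refine hf0 ?_
    have hfdot : ∀ x, (fun i => f (Pi.single i 1)) ⬝ᵥ x = f x := by
      intro x
      conv_rhs => rw [pi_eq_sum_univ' x, map_sum]
      simp [dotProduct, mul_comm]
    have hmem : (fun i => f (Pi.single i 1)) ∈ N := fun t ht y =>
      dotProduct_flow_eq_zero A B (fun u => by rw [hfdot]; exact hf ⟨u, rfl⟩) ht y
    rw [hN, Submodule.mem_bot] at hmem
    ext1 i
    ext
    simpa using congrFun hmem i
  obtain ⟨μ, v, hvN, hv0, hv⟩ := exists_eigenvector_mem hA hinv hbot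
  refine hv0 (h μ v hv ?_)
  -- By continuity the identity extends to `t = 0`, where the flow is the identity.
  have hzero : ∀ y, v ⬝ᵥ (B *ᵥ y) = 0 := by
    intro y
    let ℓ : (n → ℝ) →L[ℝ] ℝ := LinearMap.toContinuousLinearMap (dotProductBilin ℝ ℝ v)
    have hc : Continuous fun t => v ⬝ᵥ flow A (-t) (B *ᵥ y) :=
      ℓ.continuous.comp (continuous_flow_neg_mulVec A B continuous_const)
    have h1 : Set.EqOn (fun t => v ⬝ᵥ flow A (-t) (B *ᵥ y)) (fun _ => 0)
        (closure (Set.Ioo 0 1)) :=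
      Set.EqOn.closure (fun t ht => hvN t ht y) hc continuous_const
    rw [closure_Ioo zero_ne_one] at h1
    simpa [flow_zero] using h1 (Set.left_mem_Icc.2 zero_le_one)
  ext i
  simpa [← Matrix.dotProduct_mulVec] using
    (Matrix.dotProduct_mulVec v B (Pi.single i 1)).symm.trans (hzero _)

/-! ### Transfer to the path graph and conclusion -/

lemma lapMatrix_mulVec_of_iso_path {V : Type*} [Fintype V] [DecidableEq V] (G : SimpleGraph V)
    [DecidableRel G.Adj] {k : ℕ} (e : G ≃g SimpleGraph.pathGraph k) (Z : ℕ → ℝ) (a : V) :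
    (G.lapMatrix ℝ *ᵥ fun b => Z (e b)) a =
      (if (e a : ℕ) + 1 < k then Z (e a) - Z (e a + 1) else 0) +
        if 1 ≤ (e a : ℕ) then Z (e a) - Z (e a - 1) else 0 := by
  -- At the left end the truncated index `e a - 1` is `0`, still in range; the inner `if` removes
  -- that spurious term.
  have hlt := (e a).isLt
  have key : ∀ j : ℕ, (if (e a : ℕ) + 1 = j ∨ j + 1 = e a then Z (e a) - Z j else 0) =
      (if (e a : ℕ) + 1 = j then Z (e a) - Z (e a + 1) else 0) +
        if (e a : ℕ) - 1 = j then if 1 ≤ (e a : ℕ) then Z (e a) - Z (e a - 1) else 0 else 0 := by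
    intro j
    split_ifs <;> first | omega | skip
    all_goals simp_all
  have h1 : ∀ b, (if G.Adj a b then Z (e a) - Z (e b) else 0) =
      if (e a : ℕ) + 1 = e b ∨ (e b : ℕ) + 1 = e a then Z (e a) - Z (e b) else 0 := by
    intro b
    simp only [← SimpleGraph.pathGraph_adj, e.map_adj_iff]
  rw [lapMatrix_mulVec_eq_sum, Finset.sum_congr rfl fun b _ => h1 b]
  refine (Equiv.sum_comp e.toEquiv (fun j : Fin k =>
      if (e a : ℕ) + 1 = j ∨ (j : ℕ) + 1 = e a then Z (e a) - Z j else 0)).trans ?_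
  rw [Fin.sum_univ_eq_sum_range (fun j : ℕ =>
      if (e a : ℕ) + 1 = j ∨ j + 1 = e a then Z (e a) - Z j else 0)]
  simp only [key, Finset.sum_add_distrib, Finset.sum_ite_eq, Finset.mem_range]
  rw [if_pos (show (e a : ℕ) - 1 < k by omega)]

lemma lapMatrix_mulVec_eq_smul_iff_isPathEigen {V : Type*} [Fintype V] [DecidableEq V]
    (G : SimpleGraph V) [DecidableRel G.Adj] {k : ℕ} (e : G ≃g SimpleGraph.pathGraph k)
    (ν : ℝ) (Z : ℕ → ℝ) :
    (G.lapMatrix ℝ *ᵥ fun b => Z (e b)) = ν • (fun b => Z (e b)) ↔ IsPathEigen k ν Z := by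
  rw [funext_iff]
  simp only [lapMatrix_mulVec_of_iso_path, Pi.smul_apply, smul_eq_mul]
  refine ⟨fun h i hi => ?_, fun h a => h _ (e a).isLt⟩
  simpa using h (e.symm ⟨i, hi⟩)

lemma exists_eigenvector_path_iff {V : Type*} [Fintype V] [DecidableEq V] (G : SimpleGraph V)
    [DecidableRel G.Adj] {a b : ℕ} (e : G ≃g SimpleGraph.pathGraph (a + b + 1)) {p : V}
    (hp : (e p : ℕ) = a) :
    (∃ (ν : ℝ) (z : V → ℝ), G.lapMatrix ℝ *ᵥ z = ν • z ∧ z p = 0 ∧ z ≠ 0) ↔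
      ∃ j : ℕ, 1 ≤ j ∧ a ∈ C j ∧ b ∈ C j := by
  rw [exists_mem_C_iff]
  constructor
  · rintro ⟨ν, z, hz, hzp, hz0⟩
    set Z : ℕ → ℝ := fun i => if h : i < a + b + 1 then z (e.symm ⟨i, h⟩) else 0 with hZ
    have hzZ : z = fun v => Z (e v) := by
      ext v
      simp only [hZ, dif_pos (e v).isLt, Fin.eta, RelIso.symm_apply_apply]
    rw [hzZ, lapMatrix_mulVec_eq_smul_iff_isPathEigen] at hz
    obtain ⟨v, hv⟩ := Function.ne_iff.1 hz0
    refine hz.not_isCoprime ?_ ⟨e v, (e v).isLt, ?_⟩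
    · rw [← hp, ← hzp, hzZ]
    · rwa [hzZ] at hv
  · intro h
    obtain ⟨ν, Z, hZ, hZa, hZ0⟩ := exists_isPathEigen h
    refine ⟨ν, fun v => Z (e v), (lapMatrix_mulVec_eq_smul_iff_isPathEigen G e ν Z).2 hZ,
      by simp only [hp, hZa], fun h0 => hZ0 ?_⟩
    simpa using congrFun h0 (e.symm ⟨0, by omega⟩)

lemma singleInputLaplacianControllable_iff {V : Type*} [Fintype V] [DecidableEq V]
    (G : SimpleGraph V) [DecidableRel G.Adj] (v : V) :
    SingleInputLaplacianControllable G v ↔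
      ¬ ∃ (μ : ℝ) (w : V → ℝ), G.lapMatrix ℝ *ᵥ w = μ • w ∧ w v = 0 ∧ w ≠ 0 := by
  have hB : ∀ w : V → ℝ, w ᵥ* inputAt v = 0 ↔ w v = 0 := by
    intro w
    simp [funext_iff, Matrix.vecMul, dotProduct, inputAt]
  rw [SingleInputLaplacianControllable,
    isControllable_iff_forall_eigenvector (G.isSymm_lapMatrix (R := ℝ)).neg]
  simp only [hB, Matrix.neg_mulVec]
  push Not
  constructor
  · intro h μ w hw hv
    exact h (-μ) w (by rw [hw, neg_smul]) hv
  · intro h μ w hw hv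
    exact h (-μ) w (by rw [neg_smul, ← hw, neg_neg]) hv

end LaplacianControl

theorem mainTheorem3
    {V₁ V₂ : Type*} [Fintype V₁] [DecidableEq V₁] [Fintype V₂] [DecidableEq V₂]
    -- the structure graph is a path on `k₁` vertices
    (G₁ : SimpleGraph V₁) [DecidableRel G₁.Adj]
    (k₁ : ℕ) (e : G₁ ≃g SimpleGraph.pathGraph k₁)
    -- the input vertex, with `k₁₁` vertices of the path on one side and `k₁₂` on the other
    (p : V₁) (k₁₁ k₁₂ : ℕ) (hk₁₁ : (e p : ℕ) = k₁₁) (hk₁₂ : k₁₁ + k₁₂ + 1 = k₁)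
    -- the cell graph with its composite vertex
    (G₂ : SimpleGraph V₂) [DecidableRel G₂.Adj] (hG₂ : G₂.Connected) (s : V₂)
    (hs : ∀ (μ : ℝ) (v : V₂ → ℝ),
      Module.End.HasEigenvector (Matrix.toLin' (G₂.lapMatrix ℝ)) μ v → v s ≠ 0) :
    LaplacianControl.SingleInputLaplacianControllable
        (LaplacianControl.composite G₁ G₂ s) (p, s) ↔
      ¬ ∃ j : ℕ, 1 ≤ j ∧ k₁₁ ∈ LaplacianControl.C j ∧ k₁₂ ∈ LaplacianControl.C j := by
  subst hk₁₂
  rw [LaplacianControl.singleInputLaplacianControllable_iff,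
    LaplacianControl.exists_eigenvector_composite_iff G₁ G₂ s p ?_,
    LaplacianControl.exists_eigenvector_path_iff G₁ e hk₁₁]
  intro μ v hv hvs
  by_contra hv0
  refine hs μ v ⟨Module.End.mem_eigenspace_iff.2 ?_, hv0⟩ hvs
  rwa [Matrix.toLin'_apply]
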